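/- Let $V_0,V_1,\dots,V_q:\mathbb{R}^d\to\mathbb{R}$ and $\beta:\mathbb{R}^d\to(0,\infty)$ be twice continuously differentiable, let $\alpha>0$, and let $\mathcal{C}=\{\theta\in\mathbb{R}^d : V_j(\theta)\le 0,\ j=1,\dots,q\}$. Put $$g_j(\theta,\xi)=\alpha V_j(\theta)+\nabla V_j(\theta)^\top\xi+\tfrac{\beta(\theta)}{2}\|\xi\|^2,\qquad j=1,\dots,q,$$ and let $\mathcal{R}_{\alpha,\beta}(\theta)$ be the minimizer of $\tfrac12\|\xi+\nabla V_0(\theta)\|^2$ over all $\xi\in\mathbb{R}^d$ with $g_j(\theta,\xi)\le 0$ for $j=1,\dots,q$ (it exists and is unique whenever these constraints are feasible; at the other points set $\mathcal{R}_{\alpha,\beta}(\theta)=0$). A trajectory of the Robust Safe Gradient Flow (RSGF) is a differentiable function $\theta:[0,\infty)\to\mathbb{R}^d$ with $\dot\theta(t)=\mathcal{R}_{\alpha,\beta}(\theta(t))$ for all $t\ge 0$. A KKT point is a point $\theta\in\mathbb{R}^d$ for which there is $u\in\mathbb{R}^q$ with $\nabla V_0(\theta)+\sum_{j=1}^q u_j\nabla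 V_j(\theta)=0$ and $V_j(\theta)\le 0$, $u_j\ge 0$, $u_jV_j(\theta)=0$ for all $j$. The constant-rank condition (CRC) at $(\theta,\xi)$ says that there is a neighborhood $\mathcal{N}$ of $(\theta,\xi)$ such that, for every $I\subseteq\{j : g_j(\theta,\xi)=0\}$, the rank of $\{\nabla_\xi g_j(\bar\theta,\bar\xi)\}_{j\in I}$ is constant for $(\bar\theta,\bar\xi)\in\mathcal{N}$. Assume that for every $\theta\in\mathcal{C}$ - the Mangasarian-Fromovitz constraint qualification holds, i.e. there is $\xi\in\mathbb{R}^d$ with $\nabla V_j(\theta)^\top\xi<0$ for all $j$ with $V_j(\theta)=0$, and - CRC holds at $(\theta,\mathcal{R}_{\alpha,\beta}(\theta))$. Then: 1. Every bounded trajectory of the RSGF with $\theta(0)\in\mathcal{C}$ converges to the set of KKT points as $t\to\infty$, that is, the set of KKT points is nonempty and the distance from $\theta(t)$ to it tends to $0$. 2. If, in addition, for every $\theta\in\mathbb{R}^d\setminus\mathcal{C}$ Slater's condition holds (there is $\xi$ with $g_j(\theta,\xi)<0$ for all $j$) and CRC holds at $(\theta,\mathcal{R}_{\alpha,\beta}(\theta))$,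 then every bounded trajectory of the RSGF converges to the set of KKT points. In either case, if every KKT point is isolated in the set of KKT points, then every trajectory considered converges, as $t\to\infty$, to a single KKT point. -/

import Mathlib

open Set Filter Topology

noncomputable section

namespace RSGF

/-! ### Inequality-constrained problems `min f x` subject to `g j x ≤ 0` -/

/-- The feasible set `{x | g j x ≤ 0 for all j}`. -/
def feasibleSet {d q : ℕ} (g : Fin q → EuclideanSpace ℝ (Fin d) → ℝ) :
    Set (EuclideanSpace ℝ (Fin d)) :=
  {x | ∀ j, g j x ≤ 0}

/-- The set of active constraints at `x`. -/
def activeSet {d q : ℕ} (g : Fin q → EuclideanSpace ℝ (Fin d) → ℝ)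
    (x : EuclideanSpace ℝ (Fin d)) : Set (Fin q) :=
  {j | g j x = 0}

/-- Slater's condition: some point satisfies all constraints strictly. -/
def Slater {d q : ℕ} (g : Fin q → EuclideanSpace ℝ (Fin d) → ℝ) : Prop :=
  ∃ x, ∀ j, g j x < 0

/-- The Mangasarian-Fromovitz constraint qualification at `x`. -/
def MFCQ {d q : ℕ} (g : Fin q → EuclideanSpace ℝ (Fin d) → ℝ)
    (x : EuclideanSpace ℝ (Fin d)) : Prop :=
  ∃ ξ : EuclideanSpace ℝ (Fin d), ∀ j ∈ activeSet g x, inner ℝ (gradient (g j) x) ξ < 0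

/-- `x` is a Karush-Kuhn-Tucker point of `min f` subject to `g j ≤ 0`. -/
def IsKKT {d q : ℕ} (f : EuclideanSpace ℝ (Fin d) → ℝ)
    (g : Fin q → EuclideanSpace ℝ (Fin d) → ℝ) (x : EuclideanSpace ℝ (Fin d)) : Prop :=
  ∃ u : Fin q → ℝ, gradient f x + ∑ j, u j • gradient (g j) x = 0 ∧
    ∀ j, g j x ≤ 0 ∧ 0 ≤ u j ∧ u j * g j x = 0

/-- The set of Karush-Kuhn-Tucker points. -/
def kktSet {d q : ℕ} (f : EuclideanSpace ℝ (Fin d) → ℝ)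
    (g : Fin q → EuclideanSpace ℝ (Fin d) → ℝ) : Set (EuclideanSpace ℝ (Fin d)) :=
  {x | IsKKT f g x}

/-- The constant-rank condition for a parametric problem with constraints `g j z x ≤ 0`, where `z` is
the parameter and `x` the decision variable, at `(z₀, x₀)`: for every set `I` of constraints active
at `(z₀, x₀)`, the rank of the family of gradients with respect to the decision variable, indexed by
`I`, is constant on a neighbourhood of `(z₀, x₀)`. -/
def ParametricCRC {c d q : ℕ}
    (g : Fin q → EuclideanSpace ℝ (Fin c) → EuclideanSpace ℝ (Fin d) → ℝ)
    (z₀ : EuclideanSpace ℝ (Fin c)) (x₀ : EuclideanSpace ℝ (Fin d)) : Prop :=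
  ∃ N ∈ 𝓝 (z₀, x₀), ∀ I ⊆ activeSet (fun j => g j z₀) x₀, ∃ r : ℕ, ∀ p ∈ N,
    Set.finrank ℝ ((fun j => gradient (g j p.1) p.2) '' I) = r

/-! ### The robust safe gradient flow -/

/-- The constraint functions, in the variable `ξ` and with parameter `θ`, of the problem that defines
the flow: `α V_j(θ) + ∇V_j(θ)ᵀ ξ + (β(θ)/2) ‖ξ‖²`. -/
def dirConstraint {d q : ℕ} (V : Fin q → EuclideanSpace ℝ (Fin d) → ℝ) (α : ℝ)
    (β : EuclideanSpace ℝ (Fin d) → ℝ) (j : Fin q) (θ ξ : EuclideanSpace ℝ (Fin d)) : ℝ :=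
  α * V j θ + inner ℝ (gradient (V j) θ) ξ + β θ / 2 * ‖ξ‖ ^ 2

/-- `ξ` minimizes `½ ‖ξ + ∇V₀(θ)‖²` subject to `dirConstraint V α β j θ ξ ≤ 0` for all `j`. -/
def IsDirection {d q : ℕ} (V₀ : EuclideanSpace ℝ (Fin d) → ℝ)
    (V : Fin q → EuclideanSpace ℝ (Fin d) → ℝ) (α : ℝ) (β : EuclideanSpace ℝ (Fin d) → ℝ)
    (θ ξ : EuclideanSpace ℝ (Fin d)) : Prop :=
  ξ ∈ feasibleSet (fun j => dirConstraint V α β j θ) ∧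
    IsMinOn (fun η => (1 / 2 : ℝ) * ‖η + gradient V₀ θ‖ ^ 2)
      (feasibleSet (fun j => dirConstraint V α β j θ)) ξ

/-- A minimizer exists as soon as the constraints are feasible. -/
theorem exists_isDirection {d q : ℕ} (V₀ : EuclideanSpace ℝ (Fin d) → ℝ)
    (V : Fin q → EuclideanSpace ℝ (Fin d) → ℝ) (α : ℝ) (β : EuclideanSpace ℝ (Fin d) → ℝ)
    (θ : EuclideanSpace ℝ (Fin d))
    (h : (feasibleSet (fun j => dirConstraint V α β j θ)).Nonempty) :
    ∃ ξ, IsDirection V₀ V α β θ ξ := by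
  have hc : IsClosed (feasibleSet (fun j => dirConstraint V α β j θ)) := by
    simp only [feasibleSet, dirConstraint, Set.ofPred_forall]
    exact isClosed_iInter fun j => isClosed_le (by fun_prop) continuous_const
  obtain ⟨ξ, hξ, hd⟩ := hc.exists_infDist_eq_dist h (-gradient V₀ θ)
  refine ⟨ξ, hξ, fun η hη => ?_⟩
  have h1 := Metric.infDist_le_dist_of_mem (x := -gradient V₀ θ) hη
  rw [hd, dist_comm, dist_comm _ η, dist_eq_norm, dist_eq_norm, sub_neg_eq_add,
    sub_neg_eq_add] at h1
  have h2 := pow_le_pow_left₀ (norm_nonneg _) h1 2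
  simp only [mem_ofPred_eq]
  linarith

/-- The minimizer is unique when `β(θ) ≥ 0`. -/
theorem isDirection_unique {d q : ℕ} (V₀ : EuclideanSpace ℝ (Fin d) → ℝ)
    (V : Fin q → EuclideanSpace ℝ (Fin d) → ℝ) (α : ℝ) (β : EuclideanSpace ℝ (Fin d) → ℝ)
    (θ ξ η : EuclideanSpace ℝ (Fin d)) (hβ : 0 ≤ β θ)
    (hξ : IsDirection V₀ V α β θ ξ) (hη : IsDirection V₀ V α β θ η) : ξ = η := by
  have par := parallelogram_law_with_norm ℝ (ξ + gradient V₀ θ) (η + gradient V₀ θ)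
  have par' := parallelogram_law_with_norm ℝ ξ η
  have hmid : (1 / 2 : ℝ) • (ξ + η) ∈ feasibleSet (fun j => dirConstraint V α β j θ) := by
    intro j
    have a := hξ.1 j
    have b := hη.1 j
    simp only [dirConstraint, inner_smul_right, inner_add_right, norm_smul] at a b ⊢
    rw [show ‖(1 / 2 : ℝ)‖ = 1 / 2 by norm_num]
    have hs : (‖ξ + η‖ / 2) ^ 2 ≤ (‖ξ‖ ^ 2 + ‖η‖ ^ 2) / 2 := by
      nlinarith [mul_self_nonneg ‖ξ - η‖]
    have := mul_le_mul_of_nonneg_left hs (by positivity : 0 ≤ β θ / 2)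
    have e : (1 / 2 * ‖ξ + η‖) ^ 2 = (‖ξ + η‖ / 2) ^ 2 := by ring
    nlinarith
  have m := hξ.2 hmid
  have m' := hξ.2 hη.1
  have m'' := hη.2 hξ.1
  simp only [mem_ofPred_eq] at m m' m''
  have e1 : ξ + gradient V₀ θ + (η + gradient V₀ θ)
      = (2 : ℝ) • ((1 / 2 : ℝ) • (ξ + η) + gradient V₀ θ) := by module
  have e2 : ξ + gradient V₀ θ - (η + gradient V₀ θ) = ξ - η := by abel
  rw [e1, e2, norm_smul] at par
  norm_num at par m
  have : ‖ξ - η‖ ^ 2 ≤ 0 := by nlinarith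
  have h0 : ‖ξ - η‖ = 0 := by nlinarith [norm_nonneg (ξ - η), sq_nonneg ‖ξ - η‖]
  exact sub_eq_zero.mp (norm_eq_zero.mp h0)

open Classical in
/-- The vector field `R_{α,β}`: the minimizer `ξ` at `θ` (and `0` if the constraints are infeasible
at `θ`). -/
def field {d q : ℕ} (V₀ : EuclideanSpace ℝ (Fin d) → ℝ)
    (V : Fin q → EuclideanSpace ℝ (Fin d) → ℝ) (α : ℝ) (β : EuclideanSpace ℝ (Fin d) → ℝ)
    (θ : EuclideanSpace ℝ (Fin d)) : EuclideanSpace ℝ (Fin d) :=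
  if h : ∃ ξ, IsDirection V₀ V α β θ ξ then h.choose else 0

/-- The vector field takes the minimizer as its value wherever the constraints are feasible. -/
theorem field_spec {d q : ℕ} (V₀ : EuclideanSpace ℝ (Fin d) → ℝ)
    (V : Fin q → EuclideanSpace ℝ (Fin d) → ℝ) (α : ℝ) (β : EuclideanSpace ℝ (Fin d) → ℝ)
    (θ : EuclideanSpace ℝ (Fin d))
    (h : (feasibleSet (fun j => dirConstraint V α β j θ)).Nonempty) :
    IsDirection V₀ V α β θ (field V₀ V α β θ) := by
  have h' := exists_isDirection V₀ V α β θ h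
  rw [field, dif_pos h']
  exact h'.choose_spec

/-- `x : [0, ∞) → ℝ^d` is a trajectory of the flow `θ' = R_{α,β}(θ)` (the derivative at time `0` is
one-sided; values of `x` at negative times play no role). -/
def IsTrajectory {d q : ℕ} (V₀ : EuclideanSpace ℝ (Fin d) → ℝ)
    (V : Fin q → EuclideanSpace ℝ (Fin d) → ℝ) (α : ℝ) (β : EuclideanSpace ℝ (Fin d) → ℝ)
    (x : ℝ → EuclideanSpace ℝ (Fin d)) : Prop :=
  ∀ t, 0 ≤ t → HasDerivWithinAt x (field V₀ V α β (x t)) (Ici 0) t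

/-- The trajectory is bounded on `[0, ∞)`. -/
def IsBoundedTrajectory {d q : ℕ} (V₀ : EuclideanSpace ℝ (Fin d) → ℝ)
    (V : Fin q → EuclideanSpace ℝ (Fin d) → ℝ) (α : ℝ) (β : EuclideanSpace ℝ (Fin d) → ℝ)
    (x : ℝ → EuclideanSpace ℝ (Fin d)) : Prop :=
  IsTrajectory V₀ V α β x ∧ Bornology.IsBounded (x '' Ici 0)

/-- The constraint qualifications in the feasible set. -/
def CQInside {d q : ℕ} (V₀ : EuclideanSpace ℝ (Fin d) → ℝ)
    (V : Fin q → EuclideanSpace ℝ (Fin d) → ℝ) (α : ℝ)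
    (β : EuclideanSpace ℝ (Fin d) → ℝ) : Prop :=
  ∀ θ ∈ feasibleSet V, MFCQ V θ ∧
    ParametricCRC (dirConstraint V α β) θ (field V₀ V α β θ)

/-- The constraint qualifications outside the feasible set. -/
def CQOutside {d q : ℕ} (V₀ : EuclideanSpace ℝ (Fin d) → ℝ)
    (V : Fin q → EuclideanSpace ℝ (Fin d) → ℝ) (α : ℝ)
    (β : EuclideanSpace ℝ (Fin d) → ℝ) : Prop :=
  ∀ θ ∉ feasibleSet V, Slater (fun j => dirConstraint V α β j θ) ∧
    ParametricCRC (dirConstraint V α β) θ (field V₀ V α β θ)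

/-- `x t` converges to the set `S` as `t → ∞`: its distance to `S` tends to `0` (in particular `S`
is not empty). -/
def ConvergesToSet {d : ℕ} (x : ℝ → EuclideanSpace ℝ (Fin d))
    (S : Set (EuclideanSpace ℝ (Fin d))) : Prop :=
  ∀ ε > 0, ∀ᶠ t in atTop, ∃ y ∈ S, dist (x t) y < ε

/-- Every point of `S` is isolated in `S`. -/
def AllIsolated {d : ℕ} (S : Set (EuclideanSpace ℝ (Fin d))) : Prop :=
  ∀ y ∈ S, ∃ U ∈ 𝓝 y, S ∩ U = {y}

end RSGF

end

open Set Filter Topology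

namespace RSGF

/-! At each `θ` with feasible constraints the field `R` is the projection of `-∇V₀(θ)` onto a convex
set of directions. Everything rests on Slater's condition for that set: in the feasible set it
follows from MFCQ by a short step along a Mangasarian-Fromovitz direction, elsewhere it is assumed.

The constraint on `R` forces `(V_j)' ≤ -α V_j` along trajectories, so the feasible set is invariant
and limit points are feasible (`antitoneOn_mul_exp`). Testing the projection inequality against a
scaled Slater point gives `⟨∇V₀, R⟩ ≤ -‖R‖² + C · violation` (`exists_eventually_descent`). The
violation decays like `exp (-α t)`, so `V₀` plus a multiple of this exponential is a Lyapunov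
function with rate at most `-‖R‖²`. As `R` is continuous at Slater points, it vanishes at every
limit point (`field_eq_zero`).

A feasible zero of `R` is a KKT point: Gordan's alternative yields either multipliers or a feasible
descent direction, and the latter contradicts `R = 0` (`isKKT_of_field_eq_zero`). Compactness then
gives convergence to the KKT set. -/

variable {d q : ℕ}

/-! ### Theorem of the alternative and gradient calculus -/

/-- Gordan's alternative for the vectors `v i`, `i ∈ s`. -/
theorem gordan_alternative {ι : Type*} [Fintype ι] (v : ι → EuclideanSpace ℝ (Fin d))
    (s : Set ι) :
    (∃ w : ι → ℝ, (∀ i, 0 ≤ w i) ∧ ∑ i, w i = 1 ∧ (∀ i ∉ s, w i = 0) ∧ ∑ i, w i • v i = 0) ∨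
      ∃ z, ∀ i ∈ s, inner ℝ (v i) z < 0 := by
  classical
  -- `T '' S` is the convex hull of the `v i` with `i ∈ s`; if it misses `0`, Hahn-Banach separates
  -- it strictly from `0`.
  set S : Set (ι → ℝ) := stdSimplex ℝ ι ∩ {w | ∀ i ∉ s, w i = 0}
  let T : (ι → ℝ) →ₗ[ℝ] EuclideanSpace ℝ (Fin d) :=
    ∑ i, (LinearMap.proj i : (ι → ℝ) →ₗ[ℝ] ℝ).smulRight (v i)
  have hT : ∀ w, T w = ∑ i, w i • v i := fun w => by simp [T]
  have hcl : IsClosed {w : ι → ℝ | ∀ i ∉ s, w i = 0} := by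
    simp only [Set.ofPred_forall]
    exact isClosed_iInter fun i => isClosed_iInter fun _ =>
      isClosed_eq (continuous_apply i) continuous_const
  have hcomp : IsCompact (T '' S) :=
    ((isCompact_stdSimplex ℝ ι).inter_right hcl).image T.continuous_of_finiteDimensional
  have hcl_conv : Convex ℝ {w : ι → ℝ | ∀ i ∉ s, w i = 0} := by
    intro a ha b hb p r _ _ _ i hi
    simp [ha i hi, hb i hi]
  have hconv : Convex ℝ (T '' S) :=
    ((convex_stdSimplex ℝ ι).inter hcl_conv).linear_image T
  by_cases h0 : (0 : EuclideanSpace ℝ (Fin d)) ∈ T '' S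
  · obtain ⟨w, ⟨hw, hws⟩, hw0⟩ := h0
    exact Or.inl ⟨w, hw.1, hw.2, hws, by rw [← hT, hw0]⟩
  · right
    obtain ⟨f, u, hf, hu⟩ := geometric_hahn_banach_closed_point hconv hcomp.isClosed h0
    rw [map_zero] at hu
    refine ⟨(InnerProductSpace.toDual ℝ _).symm f, fun i hi => ?_⟩
    rw [real_inner_comm, InnerProductSpace.toDual_symm_apply]
    refine (hf (v i) ⟨Pi.single i 1, ⟨single_mem_stdSimplex ℝ i, fun k hk => ?_⟩, ?_⟩).trans hu
    · exact Pi.single_eq_of_ne (fun e : k = i => hk (e.symm ▸ hi)) _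
    · rw [hT, Finset.sum_eq_single i]
      · simp
      · intro b _ hb
        simp [Pi.single_eq_of_ne hb]
      · simp

theorem continuous_gradient {f : EuclideanSpace ℝ (Fin d) → ℝ} (hf : ContDiff ℝ 2 f) :
    Continuous (gradient f) :=
  (InnerProductSpace.toDual ℝ _).symm.continuous.comp (hf.continuous_fderiv (by norm_num))

/-- The chain rule along a curve, in terms of the gradient. -/
theorem hasDerivWithinAt_comp_gradient {f : EuclideanSpace ℝ (Fin d) → ℝ} (hf : ContDiff ℝ 2 f)
    {x : ℝ → EuclideanSpace ℝ (Fin d)} {v : EuclideanSpace ℝ (Fin d)} {s : Set ℝ} {t : ℝ}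
    (hx : HasDerivWithinAt x v s t) :
    HasDerivWithinAt (fun t => f (x t)) (inner ℝ (gradient f (x t)) v) s t := by
  have h := (hf.differentiable (by norm_num) (x t)).hasFDerivAt.comp_hasDerivWithinAt t hx
  rwa [← inner_gradient_left] at h

/-! ### The projection problem and its link with KKT points -/

variable {V₀ : EuclideanSpace ℝ (Fin d) → ℝ} {V : Fin q → EuclideanSpace ℝ (Fin d) → ℝ}
  {α : ℝ} {β : EuclideanSpace ℝ (Fin d) → ℝ}

theorem continuous_dirConstraint (hV : ∀ j, ContDiff ℝ 2 (V j)) (hβ' : Continuous β) (j : Fin q) :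
    Continuous fun p : EuclideanSpace ℝ (Fin d) × EuclideanSpace ℝ (Fin d) =>
      dirConstraint V α β j p.1 p.2 := by
  have h1 := (hV j).continuous
  have h2 := continuous_gradient (hV j)
  unfold dirConstraint
  fun_prop

/-- `dirConstraint` is convex in the direction. -/
theorem dirConstraint_add_smul_sub_le {θ : EuclideanSpace ℝ (Fin d)} (hβ : 0 ≤ β θ) (j : Fin q)
    (η ζ : EuclideanSpace ℝ (Fin d)) {s : ℝ} (hs : 0 ≤ s) (hs1 : s ≤ 1) :
    dirConstraint V α β j θ (η + s • (ζ - η)) ≤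
      (1 - s) * dirConstraint V α β j θ η + s * dirConstraint V α β j θ ζ := by
  -- The two sides differ by exactly `s (1 - s) ‖ζ - η‖²`.
  have key : ‖η + s • (ζ - η)‖ ^ 2 ≤ (1 - s) * ‖η‖ ^ 2 + s * ‖ζ‖ ^ 2 := by
    have e1 := norm_add_sq_real η (s • (ζ - η))
    have e2 := norm_add_sq_real η (ζ - η)
    rw [add_sub_cancel] at e2
    rw [inner_smul_right, norm_smul, mul_pow, Real.norm_eq_abs, sq_abs] at e1
    nlinarith [mul_nonneg (mul_nonneg hs (sub_nonneg.2 hs1)) (sq_nonneg ‖ζ - η‖)]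
  have := mul_le_mul_of_nonneg_left key (by positivity : 0 ≤ β θ / 2)
  simp only [dirConstraint, inner_add_right, inner_smul_right, inner_sub_right]
  nlinarith

/-- At a feasible point, short steps along a Mangasarian-Fromovitz direction are Slater points. -/
theorem eventually_dirConstraint_smul_neg (hα : 0 < α) {θ : EuclideanSpace ℝ (Fin d)}
    (hθ : θ ∈ feasibleSet V) {z : EuclideanSpace ℝ (Fin d)}
    (hz : ∀ j ∈ activeSet V θ, inner ℝ (gradient (V j) θ) z < 0) :
    ∀ᶠ s : ℝ in 𝓝[>] 0, ∀ j, dirConstraint V α β j θ (s • z) < 0 := by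
  rw [eventually_all]
  intro j
  have hj := hθ j
  rcases hj.lt_or_eq with hlt | heq
  · have hc : Continuous fun s : ℝ => dirConstraint V α β j θ (s • z) := by
      unfold dirConstraint; fun_prop
    have h0 : dirConstraint V α β j θ ((0 : ℝ) • z) < 0 := by
      simpa [dirConstraint] using mul_neg_of_pos_of_neg hα hlt
    exact nhdsWithin_le_nhds (hc.continuousAt.eventually_lt_const h0)
  · have hz' := hz j heq
    -- An active constraint at `s • z` equals `s` times this expression, so its sign for small `s >
    -- 0` is that of the value at `s = 0`.
    have hc : Continuous fun s : ℝ => inner ℝ (gradient (V j) θ) z + β θ / 2 * (s * ‖z‖ ^ 2) := by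
      fun_prop
    have h0 : inner ℝ (gradient (V j) θ) z + β θ / 2 * ((0 : ℝ) * ‖z‖ ^ 2) < 0 := by
      rwa [zero_mul, mul_zero, add_zero]
    filter_upwards [nhdsWithin_le_nhds (hc.continuousAt.eventually_lt_const h0),
      self_mem_nhdsWithin] with s hs hpos
    have := mul_neg_of_pos_of_neg (show (0 : ℝ) < s from hpos) hs
    rw [dirConstraint, heq, inner_smul_right, norm_smul, mul_pow, Real.norm_eq_abs, sq_abs]
    linarith

/-- The variational inequality that characterizes the minimizer. -/
theorem inner_field_add_gradient_nonneg {θ η : EuclideanSpace ℝ (Fin d)} (hβ : 0 ≤ β θ)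
    (hη : η ∈ feasibleSet (fun j => dirConstraint V α β j θ)) :
    0 ≤ inner ℝ (field V₀ V α β θ + gradient V₀ θ) (η - field V₀ V α β θ) := by
  obtain ⟨hR, hmin⟩ := field_spec V₀ V α β θ ⟨η, hη⟩
  set R := field V₀ V α β θ
  -- Compare `R` with a point of the segment towards `η`, divide by `s`, then let `s` tend to `0`.
  have key : ∀ s : ℝ, 0 < s → s ≤ 1 →
      0 ≤ inner ℝ (R + gradient V₀ θ) (η - R) + s * (‖η - R‖ ^ 2 / 2) := by
    intro s hs hs1
    have hmem : R + s • (η - R) ∈ feasibleSet (fun j => dirConstraint V α β j θ) := by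
      intro j
      refine (dirConstraint_add_smul_sub_le hβ j R η hs.le hs1).trans ?_
      have h1 := mul_nonpos_of_nonneg_of_nonpos (sub_nonneg.2 hs1) (hR j)
      have h2 := mul_nonpos_of_nonneg_of_nonpos hs.le (hη j)
      linarith
    have hm := hmin hmem
    simp only [mem_ofPred_eq] at hm
    rw [add_right_comm, norm_add_sq_real (R + gradient V₀ θ), inner_smul_right,
      norm_smul, mul_pow, Real.norm_eq_abs, sq_abs] at hm
    have : 0 ≤ s * (inner ℝ (R + gradient V₀ θ) (η - R) + s * (‖η - R‖ ^ 2 / 2)) := by linarith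
    exact nonneg_of_mul_nonneg_right this hs
  have hc : Continuous fun s : ℝ =>
      inner ℝ (R + gradient V₀ θ) (η - R) + s * (‖η - R‖ ^ 2 / 2) := by fun_prop
  have ht := hc.continuousAt.tendsto (x := 0) |>.mono_left (nhdsWithin_le_nhds (s := Ioi 0))
  rw [zero_mul, add_zero] at ht
  refine ge_of_tendsto ht ?_
  filter_upwards [Ioc_mem_nhdsGT (zero_lt_one' ℝ)] with s hs using key s hs.1 hs.2

/-- Zeros of the field in the feasible set are KKT points. -/
theorem isKKT_of_field_eq_zero (hα : 0 < α) {θ : EuclideanSpace ℝ (Fin d)} (hβ : 0 ≤ β θ)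
    (hθ : θ ∈ feasibleSet V) (hcq : MFCQ V θ) (h0 : field V₀ V α β θ = 0) : IsKKT V₀ V θ := by
  -- The index `none` stands for the objective; it and the active constraints form the index set of
  -- the alternative.
  let v : Option (Fin q) → EuclideanSpace ℝ (Fin d) :=
    fun o => o.elim (gradient V₀ θ) fun j => gradient (V j) θ
  rcases gordan_alternative v {o | ∀ j, o = some j → V j θ = 0} with
    ⟨w, hw, hw1, hws, hwv⟩ | ⟨z, hz⟩
  · rw [Fintype.sum_option] at hw1 hwv
    have hcompl : ∀ j, w (some j) * V j θ = 0 := by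
      intro j
      by_cases hj : V j θ = 0
      · rw [hj, mul_zero]
      · rw [hws (some j) fun h => hj (h j rfl), zero_mul]
    -- With no weight on the objective, pairing the relation with a Mangasarian-Fromovitz direction
    -- would make all weights vanish, against total weight `1`.
    have hpos : 0 < w none := by
      refine (hw none).lt_of_ne fun hnone => ?_
      obtain ⟨ξ, hξ⟩ := hcq
      rw [← hnone, zero_add] at hw1
      rw [← hnone, zero_smul, zero_add] at hwv
      have hsum : ∑ j, w (some j) * inner ℝ (gradient (V j) θ) ξ = 0 := by
        have := congrArg (fun y => inner ℝ y ξ) hwv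
        simpa [sum_inner, inner_smul_left, v] using this
      have hle : ∀ j ∈ Finset.univ, w (some j) * inner ℝ (gradient (V j) θ) ξ ≤ 0 := by
        intro j _
        rcases mul_eq_zero.1 (hcompl j) with h | h
        · rw [h, zero_mul]
        · exact mul_nonpos_of_nonneg_of_nonpos (hw _) (hξ j h).le
      have hall := (Finset.sum_eq_zero_iff_of_nonpos hle).1 hsum
      have hzero : ∀ j, w (some j) = 0 := by
        intro j
        by_contra hne
        have hj := (mul_eq_zero.1 (hcompl j)).resolve_left hne
        rcases mul_eq_zero.1 (hall j (Finset.mem_univ j)) with h | h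
        · exact hne h
        · exact (hξ j hj).ne h
      simp [hzero] at hw1
    refine ⟨fun j => w (some j) / w none, ?_, fun j => ⟨hθ j, div_nonneg (hw _) hpos.le, ?_⟩⟩
    · have := congrArg (fun y => (w none)⁻¹ • y) hwv
      simpa [smul_add, smul_smul, hpos.ne', Finset.smul_sum, v, div_eq_inv_mul] using this
    · rw [div_mul_eq_mul_div, hcompl, zero_div]
  · exfalso
    have hz0 : inner ℝ (gradient V₀ θ) z < 0 := hz none (by simp)
    have hev := eventually_dirConstraint_smul_neg (β := β) hα hθ (z := z) fun j hj =>
      hz (some j) (by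
      rintro k hk
      cases hk
      exact hj)
    obtain ⟨s, hs, hspos⟩ := (hev.and self_mem_nhdsWithin).exists
    have := inner_field_add_gradient_nonneg (V₀ := V₀) hβ (η := s • z) fun j => (hs j).le
    rw [h0, zero_add, sub_zero, inner_smul_right] at this
    exact absurd (mul_neg_of_pos_of_neg hspos hz0) this.not_gt

/-! ### Boundedness, descent and continuity of the field at Slater points -/

/-- Slater's condition is stable under perturbation of the parameter. -/
theorem eventually_dirConstraint_lt (hV : ∀ j, ContDiff ℝ 2 (V j)) (hβ' : Continuous β)
    {y η : EuclideanSpace ℝ (Fin d)} {c : Fin q → ℝ} (h : ∀ j, dirConstraint V α β j y η < c j) :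
    ∀ᶠ θ in 𝓝 y, ∀ j, dirConstraint V α β j θ η < c j := by
  rw [eventually_all]
  intro j
  have hc : Continuous fun θ => dirConstraint V α β j θ η :=
    (continuous_dirConstraint hV hβ' j).comp (by fun_prop : Continuous fun θ => (θ, η))
  exact hc.continuousAt.eventually_lt_const (h j)

theorem eventually_feasible (hV : ∀ j, ContDiff ℝ 2 (V j)) (hβ' : Continuous β)
    {y : EuclideanSpace ℝ (Fin d)} (h : Slater fun j => dirConstraint V α β j y) :
    ∀ᶠ θ in 𝓝 y, (feasibleSet fun j => dirConstraint V α β j θ).Nonempty := by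
  obtain ⟨η, hη⟩ := h
  filter_upwards [eventually_dirConstraint_lt (c := 0) hV hβ' hη] with θ hθ
  exact ⟨η, fun j => (hθ j).le⟩

/-- The projection is at least as close to `-∇V₀(θ)` as `η`; two triangle inequalities finish. -/
theorem norm_field_le {θ η : EuclideanSpace ℝ (Fin d)}
    (hη : η ∈ feasibleSet (fun j => dirConstraint V α β j θ)) :
    ‖field V₀ V α β θ‖ ≤ ‖η‖ + 2 * ‖gradient V₀ θ‖ := by
  have hm := (field_spec V₀ V α β θ ⟨η, hη⟩).2 hη
  simp only [mem_ofPred_eq] at hm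
  have h1 : ‖field V₀ V α β θ + gradient V₀ θ‖ ≤ ‖η + gradient V₀ θ‖ :=
    pow_le_pow_iff_left₀ (norm_nonneg _) (norm_nonneg _) two_ne_zero |>.1 (by linarith)
  have h2 := norm_sub_le (field V₀ V α β θ + gradient V₀ θ) (gradient V₀ θ)
  rw [add_sub_cancel_right] at h2
  linarith [norm_add_le η (gradient V₀ θ)]

/-- Near a point where Slater's condition holds, the field is bounded and decreases the objective
up to a multiple of the constraint violation. -/
theorem exists_eventually_descent (hα : 0 < α) (hβ : ∀ θ, 0 < β θ) (hV₀ : ContDiff ℝ 2 V₀)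
    (hV : ∀ j, ContDiff ℝ 2 (V j)) (hβ' : Continuous β)
    {y : EuclideanSpace ℝ (Fin d)} (h : Slater fun j => dirConstraint V α β j y) :
    ∃ C, 0 ≤ C ∧ ∀ᶠ θ in 𝓝 y, ‖field V₀ V α β θ‖ ≤ C ∧
      inner ℝ (gradient V₀ θ) (field V₀ V α β θ) ≤
        -‖field V₀ V α β θ‖ ^ 2 + C * ∑ j, max (V j θ) 0 := by
  obtain ⟨η, hη⟩ := h
  obtain ⟨δ, hδ, hδη⟩ : ∃ δ > 0, ∀ j, dirConstraint V α β j y η < -δ := by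
    have : ∀ᶠ δ : ℝ in 𝓝[>] 0, ∀ j, dirConstraint V α β j y η < -δ := by
      rw [eventually_all]
      intro j
      refine nhdsWithin_le_nhds (eventually_lt_nhds (neg_pos.2 (hη j)) |>.mono fun δ hδ => ?_)
      linarith
    obtain ⟨δ, h1, h2⟩ := (this.and self_mem_nhdsWithin).exists
    exact ⟨δ, h2, h1⟩
  set G := ‖gradient V₀ y‖ + 1
  have hG : 0 < G := by positivity
  set A := ‖η‖ + 2 * G
  have hA : 0 ≤ A := by positivity
  refine ⟨max A ((A + G) * ‖η‖ * (α / δ)), le_max_of_le_left hA, ?_⟩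
  filter_upwards [eventually_dirConstraint_lt hV hβ' hδη,
    (continuous_gradient hV₀).norm.continuousAt.eventually_lt_const (lt_add_one ‖gradient V₀ y‖)]
    with θ hθ hgrad
  have hfeas : η ∈ feasibleSet fun j => dirConstraint V α β j θ :=
    fun j => (hθ j).le.trans (by linarith)
  have hR : ‖field V₀ V α β θ‖ ≤ A := (norm_field_le hfeas).trans (by simp only [A, G]; linarith)
  refine ⟨hR.trans (le_max_left _ _), ?_⟩
  set v := ∑ j, max (V j θ) 0
  have hv : 0 ≤ v := Finset.sum_nonneg fun j _ => le_max_right _ _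
  have hVv : ∀ j, V j θ ≤ v := fun j => (le_max_left _ _).trans
    (Finset.single_le_sum (f := fun j => max (V j θ) 0) (fun j _ => le_max_right _ _)
      (Finset.mem_univ j))
  have hαv : 0 ≤ α * v := by positivity
  -- The constraints are at most `α v` at `0` and at most `-δ` at `η`; this `s` solves `(1 - s) α v
  -- = s δ`, so `s • η` is feasible by convexity. The cost `s ≤ α v / δ` is linear in the violation.
  set s := α * v / (α * v + δ)
  have hs0 : 0 ≤ s := by positivity
  have hs1 : s ≤ 1 := (div_le_one (by positivity)).2 (by linarith)
  have hsmem : s • η ∈ feasibleSet fun j => dirConstraint V α β j θ := by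
    intro j
    have h1 := dirConstraint_add_smul_sub_le (V := V) (α := α) (hβ θ).le j 0 η hs0 hs1
    have h2 : dirConstraint V α β j θ 0 = α * V j θ := by simp [dirConstraint]
    rw [h2, zero_add, sub_zero] at h1
    refine h1.trans ?_
    have h3 : (1 - s) * (α * V j θ) ≤ (1 - s) * (α * v) :=
      mul_le_mul_of_nonneg_left (mul_le_mul_of_nonneg_left (hVv j) hα.le) (by linarith)
    have h4 := mul_le_mul_of_nonneg_left (hθ j).le hs0
    have h5 : s * (α * v + δ) = α * v := div_mul_cancel₀ _ (by positivity)
    linarith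
  have hvi := inner_field_add_gradient_nonneg (V₀ := V₀) (hβ θ).le hsmem
  set R := field V₀ V α β θ
  rw [inner_sub_right, inner_smul_right, inner_add_left R _ R, real_inner_self_eq_norm_sq] at hvi
  have h6 : inner ℝ (R + gradient V₀ θ) η ≤ (A + G) * ‖η‖ :=
    (real_inner_le_norm _ _).trans (mul_le_mul_of_nonneg_right
      ((norm_add_le _ _).trans (add_le_add hR hgrad.le)) (norm_nonneg _))
  have h7 : s * inner ℝ (R + gradient V₀ θ) η ≤ (α * v / δ) * ((A + G) * ‖η‖) := by
    refine (mul_le_mul_of_nonneg_left h6 hs0).trans (mul_le_mul_of_nonneg_right ?_ (by positivity))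
    exact div_le_div_of_nonneg_left hαv hδ (by linarith)
  have h8 : (α * v / δ) * ((A + G) * ‖η‖) = (A + G) * ‖η‖ * (α / δ) * v := by ring
  have h9 := mul_le_mul_of_nonneg_right (le_max_right A ((A + G) * ‖η‖ * (α / δ))) hv
  linarith

/-- The field is continuous wherever Slater's condition holds. -/
theorem continuousAt_field (hα : 0 < α) (hβ : ∀ θ, 0 < β θ) (hV₀ : ContDiff ℝ 2 V₀)
    (hV : ∀ j, ContDiff ℝ 2 (V j)) (hβ' : Continuous β)
    {y : EuclideanSpace ℝ (Fin d)} (h : Slater fun j => dirConstraint V α β j y) :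
    ContinuousAt (field V₀ V α β) y := by
  obtain ⟨C, -, hC⟩ := exists_eventually_descent hα hβ hV₀ hV hβ' h
  have hfeas := eventually_feasible hV hβ' h
  -- The field is locally bounded, so it suffices that each of its cluster points at `y` solves the
  -- limiting problem, whose solution is unique.
  refine (isCompact_closedBall (0 : EuclideanSpace ℝ (Fin d)) C).tendsto_nhds_of_unique_mapClusterPt
    (hC.mono fun θ hθ => by simpa using hθ.1) fun ξ _ hξ => ?_
  obtain ⟨U, hU, hξ⟩ := mapClusterPt_iff_ultrafilter.1 hξ
  have hid : Tendsto (fun θ => θ) (U : Filter _) (𝓝 y) := hU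
  have hgrad : Tendsto (gradient V₀) (U : Filter _) (𝓝 (gradient V₀ y)) :=
    (continuous_gradient hV₀).continuousAt.tendsto.comp hid
  refine isDirection_unique V₀ V α β y ξ _ (hβ y).le ⟨fun j => ?_, fun η hη => ?_⟩
    (field_spec V₀ V α β y hfeas.self_of_nhds)
  · refine le_of_tendsto ((continuous_dirConstraint (α := α) hV hβ' j).continuousAt.tendsto.comp
      (hid.prodMk_nhds hξ)) ?_
    filter_upwards [hU hfeas] with θ hθ
    exact (field_spec V₀ V α β θ hθ).1 j
  · obtain ⟨ζ, hζ⟩ := h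
    simp only [mem_ofPred_eq]
    -- The competitor `η` may become infeasible for nearby `θ`; moved slightly towards the Slater
    -- point `ζ` it stays feasible.
    have key : ∀ s : ℝ, 0 < s → s ≤ 1 → 1 / 2 * ‖ξ + gradient V₀ y‖ ^ 2 ≤
        1 / 2 * ‖η + s • (ζ - η) + gradient V₀ y‖ ^ 2 := by
      intro s hs hs1
      have hst : ∀ j, dirConstraint V α β j y (η + s • (ζ - η)) < 0 := fun j => by
        refine (dirConstraint_add_smul_sub_le (hβ y).le j η ζ hs.le hs1).trans_lt ?_
        have h1 := mul_nonpos_of_nonneg_of_nonpos (sub_nonneg.2 hs1) (hη j)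
        have h2 := mul_neg_of_pos_of_neg hs (hζ j)
        linarith
      refine le_of_tendsto_of_tendsto (((hξ.add hgrad).norm.pow 2).const_mul (1 / 2))
        (((hgrad.const_add (η + s • (ζ - η))).norm.pow 2).const_mul (1 / 2)) ?_
      filter_upwards [hU (eventually_dirConstraint_lt (c := 0) hV hβ' hst)] with θ hθ
      have hmem : η + s • (ζ - η) ∈ feasibleSet fun j => dirConstraint V α β j θ :=
        fun j => (hθ j).le
      exact (field_spec V₀ V α β θ ⟨_, hmem⟩).2 hmem
    have hc : Continuous fun s : ℝ => 1 / 2 * ‖η + s • (ζ - η) + gradient V₀ y‖ ^ 2 := by fun_prop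
    have ht := hc.continuousAt.tendsto (x := 0) |>.mono_left (nhdsWithin_le_nhds (s := Ioi 0))
    rw [zero_smul, add_zero] at ht
    refine ge_of_tendsto ht ?_
    filter_upwards [Ioc_mem_nhdsGT (zero_lt_one' ℝ)] with s hs using key s hs.1 hs.2

/-! ### Decay of the constraints and forward invariance -/

variable {x : ℝ → EuclideanSpace ℝ (Fin d)}

theorem IsTrajectory.continuousOn (hx : IsTrajectory V₀ V α β x) : ContinuousOn x (Ici 0) :=
  fun t ht => (hx t ht).continuousWithinAt

/-- As long as the constraints are feasible, `V j` decays exponentially along trajectories. -/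
theorem IsTrajectory.antitoneOn_mul_exp (hβ : ∀ θ, 0 < β θ) (hV : ∀ j, ContDiff ℝ 2 (V j))
    (hx : IsTrajectory V₀ V α β x) {D : Set ℝ} (hD : Convex ℝ D) (hD0 : D ⊆ Ici 0)
    (hfeas : ∀ t ∈ D, (feasibleSet fun j => dirConstraint V α β j (x t)).Nonempty) (j : Fin q) :
    AntitoneOn (fun t => V j (x t) * Real.exp (α * t)) D := by
  have hder : ∀ t ∈ D, HasDerivWithinAt (fun t => V j (x t) * Real.exp (α * t))
      (inner ℝ (gradient (V j) (x t)) (field V₀ V α β (x t)) * Real.exp (α * t) +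
        V j (x t) * (Real.exp (α * t) * (α * 1))) D t := fun t ht =>
    (hasDerivWithinAt_comp_gradient (hV j) ((hx t (hD0 ht)).mono hD0)).mul
      ((hasDerivWithinAt_id t D).const_mul α).exp
  refine antitoneOn_of_hasDerivWithinAt_nonpos hD (fun t ht => (hder t ht).continuousWithinAt)
    (fun t ht => (hder t (interior_subset ht)).mono interior_subset) fun t ht => ?_
  have h := (field_spec V₀ V α β (x t) (hfeas t (interior_subset ht))).1 j
  simp only [dirConstraint] at h
  have h1 : 0 ≤ β (x t) / 2 * ‖field V₀ V α β (x t)‖ ^ 2 := by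
    have := hβ (x t)
    positivity
  have h2 := mul_nonpos_of_nonneg_of_nonpos (Real.exp_nonneg (α * t))
    (show α * V j (x t) + inner ℝ (gradient (V j) (x t)) (field V₀ V α β (x t)) ≤ 0 by linarith)
  linarith

theorem isClosed_feasibleSet (hV : ∀ j, ContDiff ℝ 2 (V j)) : IsClosed (feasibleSet V) := by
  simp only [feasibleSet, Set.ofPred_forall]
  exact isClosed_iInter fun j => isClosed_le (hV j).continuous continuous_const

/-- The feasible set is forward invariant. -/
theorem IsTrajectory.mem_feasibleSet (hβ : ∀ θ, 0 < β θ) (hV : ∀ j, ContDiff ℝ 2 (V j))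
    (hβ' : Continuous β) (hx : IsTrajectory V₀ V α β x)
    (hslater : ∀ y ∈ feasibleSet V, Slater fun j => dirConstraint V α β j y)
    (h0 : x 0 ∈ feasibleSet V) {T : ℝ} (hT : 0 ≤ T) : x T ∈ feasibleSet V := by
  have hcl : IsClosed (x ⁻¹' feasibleSet V ∩ Icc 0 T) := by
    rw [inter_comm]
    exact (hx.continuousOn.mono Icc_subset_Ici_self).preimage_isClosed_of_isClosed isClosed_Icc
      (isClosed_feasibleSet hV)
  -- Continuous induction: from a feasible time, Slater's condition keeps the direction problem
  -- feasible for a short while, and then the decay of `V j` preserves its sign.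
  refine hcl.Icc_subset_of_forall_mem_nhdsWithin h0 (fun t ht => ?_) ⟨hT, le_rfl⟩
  obtain ⟨htC, ht0, -⟩ := ht
  have hcont : Tendsto x (𝓝[≥] t) (𝓝 (x t)) :=
    (hx.continuousOn t ht0).mono_left (nhdsWithin_mono _ (Ici_subset_Ici.2 ht0))
  obtain ⟨b, htb, hb⟩ := mem_nhdsGE_iff_exists_Icc_subset.1
    (hcont (eventually_feasible hV hβ' (hslater _ htC)))
  filter_upwards [Icc_mem_nhdsGT htb] with s hs j
  have hanti := hx.antitoneOn_mul_exp hβ hV (convex_Icc t b) (fun r hr => ht0.trans hr.1)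
    (fun r hr => hb hr) j ⟨le_rfl, hs.1.trans hs.2⟩ hs hs.1
  have h1 := mul_nonpos_of_nonpos_of_nonneg (htC j) (Real.exp_nonneg (α * t))
  exact nonpos_of_mul_nonpos_left (hanti.trans h1) (Real.exp_pos _)

/-! ### Lyapunov function and limit points -/

/-- Under Slater's condition along a bounded trajectory, the objective plus an exponentially
decaying term decreases at a rate of at least `‖x'‖²`. -/
theorem IsBoundedTrajectory.exists_lyapunov (hα : 0 < α) (hβ : ∀ θ, 0 < β θ)
    (hV₀ : ContDiff ℝ 2 V₀) (hV : ∀ j, ContDiff ℝ 2 (V j)) (hβ' : Continuous β)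
    (hx : IsBoundedTrajectory V₀ V α β x)
    (hslater : ∀ y ∈ closure (x '' Ici 0), Slater fun j => dirConstraint V α β j y) :
    (∃ C, ∀ t, 0 ≤ t → ‖field V₀ V α β (x t)‖ ≤ C) ∧ ∃ W W' : ℝ → ℝ,
      (∀ t, 0 ≤ t → HasDerivWithinAt W (W' t) (Ici 0) t) ∧
      (∀ t, 0 ≤ t → W' t ≤ -‖field V₀ V α β (x t)‖ ^ 2) ∧ ∃ m, ∀ t, 0 ≤ t → m ≤ W t := by
  obtain ⟨hx, hbdd⟩ := hx
  have hK : IsCompact (closure (x '' Ici 0)) := hbdd.isCompact_closure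
  have hmem : ∀ t, 0 ≤ t → x t ∈ closure (x '' Ici 0) := fun t ht =>
    subset_closure (mem_image_of_mem x ht)
  obtain ⟨C, hC0, hC⟩ : ∃ C, 0 ≤ C ∧ ∀ θ ∈ closure (x '' Ici 0), ‖field V₀ V α β θ‖ ≤ C ∧
      inner ℝ (gradient V₀ θ) (field V₀ V α β θ) ≤
        -‖field V₀ V α β θ‖ ^ 2 + C * ∑ j, max (V j θ) 0 := by
    refine hK.induction_on (p := fun S => ∃ C, 0 ≤ C ∧ ∀ θ ∈ S, ‖field V₀ V α β θ‖ ≤ C ∧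
      inner ℝ (gradient V₀ θ) (field V₀ V α β θ) ≤
        -‖field V₀ V α β θ‖ ^ 2 + C * ∑ j, max (V j θ) 0) ⟨0, le_rfl, by simp⟩ ?_ ?_ ?_
    · rintro S T hST ⟨C, hC0, hC⟩
      exact ⟨C, hC0, fun θ hθ => hC θ (hST hθ)⟩
    · rintro S T ⟨C, hC0, hC⟩ ⟨C', hC0', hC'⟩
      refine ⟨C + C', add_nonneg hC0 hC0', fun θ hθ => ?_⟩
      have hv : 0 ≤ ∑ j, max (V j θ) 0 := Finset.sum_nonneg fun j _ => le_max_right _ _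
      have h1 := mul_nonneg hC0 hv
      have h2 := mul_nonneg hC0' hv
      rw [add_mul]
      rcases hθ with hθ | hθ
      · obtain ⟨h3, h4⟩ := hC θ hθ
        exact ⟨by linarith, by linarith⟩
      · obtain ⟨h3, h4⟩ := hC' θ hθ
        exact ⟨by linarith, by linarith⟩
    · intro y hy
      obtain ⟨C, hC0, hC⟩ := exists_eventually_descent hα hβ hV₀ hV hβ' (hslater y hy)
      exact ⟨_, nhdsWithin_le_nhds hC, C, hC0, fun θ hθ => hθ⟩
  refine ⟨⟨C, fun t ht => (hC _ (hmem t ht)).1⟩, ?_⟩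
  have hdecay : ∀ t, 0 ≤ t → ∑ j, max (V j (x t)) 0 ≤
      (∑ j, max (V j (x 0)) 0) * Real.exp (-(α * t)) := by
    intro t ht
    rw [Finset.sum_mul]
    refine Finset.sum_le_sum fun j _ => ?_
    have hanti := hx.antitoneOn_mul_exp hβ hV (convex_Ici 0) subset_rfl (fun r hr =>
      (eventually_feasible hV hβ' (hslater _ (hmem r hr))).self_of_nhds) j self_mem_Ici ht ht
    simp only [mul_zero, Real.exp_zero, mul_one] at hanti
    refine max_le ?_ (mul_nonneg (le_max_right _ _) (Real.exp_nonneg _))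
    rw [Real.exp_neg, ← div_eq_mul_inv, le_div_iff₀ (Real.exp_pos _)]
    exact hanti.trans (le_max_left _ _)
  set B := ∑ j, max (V j (x 0)) 0
  have hB : 0 ≤ B := Finset.sum_nonneg fun j _ => le_max_right _ _
  -- The added term has derivative `-C B exp (-α t)`, which absorbs the bound on `C` times the
  -- violation.
  refine ⟨fun t => V₀ (x t) + C * B / α * Real.exp (-(α * t)), _, fun t ht =>
    (hasDerivWithinAt_comp_gradient hV₀ (hx t ht)).add
      ((((hasDerivWithinAt_id t (Ici 0)).const_mul α).neg.exp).const_mul (C * B / α)),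
    fun t ht => ?_, ?_⟩
  · have h1 := (hC _ (hmem t ht)).2
    have h2 := mul_le_mul_of_nonneg_left (hdecay t ht) hC0
    have h3 : C * B / α * (Real.exp (-(α * t)) * -(α * 1)) = -(C * (B * Real.exp (-(α * t)))) := by
      field_simp
    simp only [Pi.neg_apply, id] at h3 ⊢
    linarith
  · obtain ⟨m, hm⟩ := (hK.image hV₀.continuous).bddBelow
    refine ⟨m, fun t ht => (hm (mem_image_of_mem V₀ (hmem t ht))).trans ?_⟩
    have : 0 ≤ C * B / α * Real.exp (-(α * t)) := by positivity
    simpa using this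

/-- The field vanishes at every limit point of a bounded trajectory. -/
theorem IsBoundedTrajectory.field_eq_zero (hα : 0 < α) (hβ : ∀ θ, 0 < β θ)
    (hV₀ : ContDiff ℝ 2 V₀) (hV : ∀ j, ContDiff ℝ 2 (V j)) (hβ' : Continuous β)
    (hx : IsBoundedTrajectory V₀ V α β x)
    (hslater : ∀ y ∈ closure (x '' Ici 0), Slater fun j => dirConstraint V α β j y)
    {y : EuclideanSpace ℝ (Fin d)} (hy : y ∈ closure (x '' Ici 0))
    (hclus : MapClusterPt y atTop x) : field V₀ V α β y = 0 := by
  obtain ⟨⟨C, hC⟩, W, W', hW, hW', m, hm⟩ := hx.exists_lyapunov hα hβ hV₀ hV hβ' hslater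
  by_contra hne
  obtain ⟨c, hc, hcy⟩ := exists_between (norm_pos_iff.2 hne)
  obtain ⟨ρ, hρ, hball⟩ := Metric.eventually_nhds_iff_ball.1
    ((continuousAt_field hα hβ hV₀ hV hβ' (hslater y hy)).norm.eventually_const_lt hcy)
  have hC0 : 0 ≤ C := (norm_nonneg _).trans (hC 0 le_rfl)
  have hWanti : AntitoneOn W (Ici 0) :=
    antitoneOn_of_hasDerivWithinAt_nonpos (convex_Ici 0) (fun t ht => (hW t ht).continuousWithinAt)
      (fun t ht => (hW t (interior_subset ht)).mono interior_subset) fun t ht =>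
      (hW' t (interior_subset ht)).trans (neg_nonpos.2 (sq_nonneg _))
  -- Truncating time with `max t 0` makes the function antitone on the whole line.
  have hlim : Tendsto (fun t => W (max t 0)) atTop (𝓝 (⨅ t, W (max t 0))) :=
    tendsto_atTop_ciInf (fun s t hst => hWanti (mem_Ici.2 (le_max_right _ _))
      (mem_Ici.2 (le_max_right _ _))
      (max_le_max_right 0 hst)) ⟨m, by rintro _ ⟨t, rfl⟩; exact hm _ (le_max_right _ _)⟩
  -- At speed at most `C` the curve moves at most `ρ / 2` in time `τ`; the `+ 1` avoids division by
  -- zero.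
  set τ := ρ / 2 / (C + 1)
  have hτ : 0 < τ := by positivity
  have hdiff := hlim.sub (hlim.comp (tendsto_atTop_add_const_right _ τ tendsto_id))
  rw [sub_self] at hdiff
  have hfreq := hclus.frequently (Metric.ball_mem_nhds y (half_pos hρ))
  obtain ⟨t, htb, htW, ht0⟩ := (hfreq.and_eventually ((hdiff.eventually_lt_const
    (show 0 < c ^ 2 * τ by positivity)).and (eventually_ge_atTop 0))).exists
  have hsub : Icc t (t + τ) ⊆ Ici 0 := fun s hs => ht0.trans hs.1
  have hfield : ∀ s ∈ Icc t (t + τ), c ≤ ‖field V₀ V α β (x s)‖ := by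
    intro s hs
    refine (hball (x s) ?_).le
    have h1 := (convex_Ici (0 : ℝ)).norm_image_sub_le_of_norm_hasDerivWithin_le
      (fun r hr => hx.1 r hr) (fun r hr => hC r hr) ht0 (hsub hs)
    have h2 : C * ‖s - t‖ ≤ ρ / 2 := by
      rw [Real.norm_of_nonneg (by linarith [hs.1])]
      calc C * (s - t) ≤ (C + 1) * τ :=
            mul_le_mul (by linarith) (by linarith [hs.2]) (by linarith [hs.1]) (by linarith)
        _ = ρ / 2 := mul_div_cancel₀ _ (by positivity)
    rw [Metric.mem_ball]
    change dist (x t) y < ρ / 2 at htb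
    have h3 := dist_triangle (x s) (x t) y
    rw [dist_eq_norm (x s) (x t)] at h3
    linarith
  have hder : ∀ s ∈ Icc t (t + τ),
      HasDerivWithinAt (fun s => W s + c ^ 2 * s) (W' s + c ^ 2 * 1) (Icc t (t + τ)) s :=
    fun s hs => ((hW s (hsub hs)).mono hsub).add ((hasDerivWithinAt_id s _).const_mul (c ^ 2))
  -- On this window `W` drops by at least `c ^ 2 * τ`, although `t` was chosen with a smaller drop.
  have hanti : AntitoneOn (fun s => W s + c ^ 2 * s) (Icc t (t + τ)) := by
    refine antitoneOn_of_hasDerivWithinAt_nonpos (convex_Icc _ _)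
      (fun s hs => (hder s hs).continuousWithinAt)
      (fun s hs => (hder s (interior_subset hs)).mono interior_subset) fun s hs => ?_
    have h1 := hW' s (hsub (interior_subset hs))
    have h2 := pow_le_pow_left₀ hc.le (hfield s (interior_subset hs)) 2
    linarith
  have hfin := hanti (left_mem_Icc.2 (by linarith)) (right_mem_Icc.2 (by linarith))
    (by linarith : t ≤ t + τ)
  simp only [Function.comp_apply, id] at htW hfin
  rw [max_eq_left ht0, max_eq_left (by linarith)] at htW
  linarith

/-- Limit points of a bounded trajectory are feasible. -/
theorem IsBoundedTrajectory.mem_feasibleSet_of_mapClusterPt (hα : 0 < α) (hβ : ∀ θ, 0 < β θ)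
    (hV : ∀ j, ContDiff ℝ 2 (V j)) (hβ' : Continuous β) (hx : IsBoundedTrajectory V₀ V α β x)
    (hslater : ∀ y ∈ closure (x '' Ici 0), Slater fun j => dirConstraint V α β j y)
    {y : EuclideanSpace ℝ (Fin d)} (hclus : MapClusterPt y atTop x) : y ∈ feasibleSet V := by
  obtain ⟨U, hU, hy⟩ := mapClusterPt_iff_ultrafilter.1 hclus
  intro j
  have hexp : Tendsto (fun t : ℝ => V j (x 0) * Real.exp (-(α * t))) atTop (𝓝 0) := by
    have := (Real.tendsto_exp_neg_atTop_nhds_zero.comp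
      (tendsto_id.const_mul_atTop hα)).const_mul (V j (x 0))
    rwa [mul_zero] at this
  refine le_of_tendsto_of_tendsto ((hV j).continuous.continuousAt.tendsto.comp hy)
    (hexp.mono_left hU) ?_
  filter_upwards [hU (eventually_ge_atTop 0)] with t ht
  have hanti := hx.1.antitoneOn_mul_exp hβ hV (convex_Ici 0) subset_rfl (fun r hr =>
    (eventually_feasible hV hβ' (hslater _ (subset_closure (mem_image_of_mem x hr)))).self_of_nhds)
    j self_mem_Ici ht ht
  simp only [mul_zero, Real.exp_zero, mul_one] at hanti
  rw [Real.exp_neg, ← div_eq_mul_inv, le_div_iff₀ (Real.exp_pos _)]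
  exact hanti

/-! ### From limit points to convergence -/

/-- A curve in a compact set all of whose limit points lie in `S` converges to `S`. -/
theorem convergesToSet_of_mapClusterPt {K S : Set (EuclideanSpace ℝ (Fin d))} (hK : IsCompact K)
    (hxK : ∀ t, 0 ≤ t → x t ∈ K) (hS : ∀ y, MapClusterPt y atTop x → y ∈ S) :
    ConvergesToSet x S := by
  intro ε hε
  by_contra hcon
  have hcl : IsClosed {z : EuclideanSpace ℝ (Fin d) | ∀ y ∈ S, ε ≤ dist z y} := by
    simp only [Set.ofPred_forall]
    exact isClosed_iInter fun y => isClosed_iInter fun _ =>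
      isClosed_le continuous_const (by fun_prop)
  -- A cluster point in this closed set would lie in `S` and yet at distance at least `ε` from
  -- itself.
  have hfreq : ∃ᶠ t in atTop, x t ∈ K ∩ {z | ∀ y ∈ S, ε ≤ dist z y} := by
    refine ((not_eventually.1 hcon).and_eventually (eventually_ge_atTop 0)).mono ?_
    rintro t ⟨h1, h2⟩
    push Not at h1
    exact ⟨hxK t h2, h1⟩
  obtain ⟨z, hz, hclus⟩ := (hK.inter_right hcl).exists_mapClusterPt_of_frequently hfreq
  exact hε.not_ge ((hz.2 z (hS z hclus)).trans_eq (dist_self z))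

/-- A continuous curve in a compact set all of whose limit points lie in a set of isolated points
converges to one of these points. -/
theorem exists_tendsto_of_allIsolated {K S : Set (EuclideanSpace ℝ (Fin d))} (hK : IsCompact K)
    (hx : ContinuousOn x (Ici 0)) (hxK : ∀ t, 0 ≤ t → x t ∈ K)
    (hS : ∀ y, MapClusterPt y atTop x → y ∈ S) (hiso : AllIsolated S) :
    ∃ y ∈ S, Tendsto x atTop (𝓝 y) := by
  have hev : ∀ᶠ t in atTop, x t ∈ K := (eventually_ge_atTop 0).mono hxK
  obtain ⟨y, -, hy⟩ := hK.exists_mapClusterPt_of_frequently hev.frequently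
  refine ⟨y, hS y hy, ?_⟩
  obtain ⟨U, hU, hUS⟩ := hiso y (hS y hy)
  obtain ⟨r, hr, hrU⟩ := Metric.mem_nhds_iff.1 hU
  rw [Metric.tendsto_nhds]
  by_contra! hcon
  obtain ⟨ε, hε, hfreq⟩ := hcon
  -- A curve that keeps coming near `y` and keeps leaving the `ε`-ball crosses this sphere
  -- infinitely often. A cluster point there lies in `S ∩ U` but differs from `y`.
  set δ := min ε (r / 2)
  have hδ : 0 < δ := lt_min hε (half_pos hr)
  have hsphere : ∃ᶠ t in atTop, x t ∈ K ∩ Metric.sphere y δ := by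
    rw [frequently_atTop]
    intro a
    obtain ⟨t₁, ht₁, h₁⟩ := ((eventually_ge_atTop (max a 0)).and_frequently
      (hy.frequently (Metric.ball_mem_nhds y hδ))).exists
    obtain ⟨t₂, ht₂, h₂⟩ := ((eventually_ge_atTop (max a 0)).and_frequently hfreq).exists
    have hle : ∀ s ∈ uIcc t₁ t₂, max a 0 ≤ s := fun s hs => (le_min ht₁ ht₂).trans hs.1
    have hc : ContinuousOn (fun s => dist (x s) y) (uIcc t₁ t₂) :=
      (continuous_id.dist continuous_const).comp_continuousOn
        (hx.mono fun s hs => (le_max_right a 0).trans (hle s hs))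
    obtain ⟨s, hs, hsδ⟩ := intermediate_value_uIcc hc
      (Icc_subset_uIcc ⟨(Metric.mem_ball.1 h₁).le, (min_le_left ε _).trans h₂⟩)
    exact ⟨s, (le_max_left _ _).trans (hle s hs),
      hxK s ((le_max_right _ _).trans (hle s hs)), hsδ⟩
  obtain ⟨z, hz, hclus⟩ := (hK.inter_right Metric.isClosed_sphere).exists_mapClusterPt_of_frequently
    hsphere
  have hzδ : dist z y = δ := hz.2
  have hzU : z ∈ S ∩ U := ⟨hS z hclus, hrU (Metric.mem_ball.2 (by
    rw [hzδ]
    exact (min_le_right _ _).trans_lt (half_lt_self hr)))⟩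
  rw [hUS, mem_singleton_iff] at hzU
  rw [hzU, dist_self] at hzδ
  exact hδ.ne hzδ

/-- Common core of both claims, which differ only in how Slater's condition on the closure of the
orbit is obtained. -/
theorem IsBoundedTrajectory.convergence (hα : 0 < α) (hβ : ∀ θ, 0 < β θ)
    (hV₀ : ContDiff ℝ 2 V₀) (hV : ∀ j, ContDiff ℝ 2 (V j)) (hβ' : Continuous β)
    (hmfcq : ∀ θ ∈ feasibleSet V, MFCQ V θ) (hx : IsBoundedTrajectory V₀ V α β x)
    (hslater : ∀ y ∈ closure (x '' Ici 0), Slater fun j => dirConstraint V α β j y) :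
    ConvergesToSet x (kktSet V₀ V) ∧
      (AllIsolated (kktSet V₀ V) → ∃ y ∈ kktSet V₀ V, Tendsto x atTop (𝓝 y)) := by
  have hK : IsCompact (closure (x '' Ici 0)) := hx.2.isCompact_closure
  have hxK : ∀ t, 0 ≤ t → x t ∈ closure (x '' Ici 0) := fun t ht =>
    subset_closure (mem_image_of_mem x ht)
  have hS : ∀ y, MapClusterPt y atTop x → y ∈ kktSet V₀ V := by
    intro y hy
    have hyK : y ∈ closure (x '' Ici 0) :=
      isClosed_closure.mem_of_mapClusterPt hy ((eventually_ge_atTop 0).mono hxK)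
    have hyC := hx.mem_feasibleSet_of_mapClusterPt hα hβ hV hβ' hslater hy
    exact isKKT_of_field_eq_zero hα (hβ y).le hyC (hmfcq y hyC)
      (hx.field_eq_zero hα hβ hV₀ hV hβ' hslater hyK hy)
  exact ⟨convergesToSet_of_mapClusterPt hK hxK hS,
    exists_tendsto_of_allIsolated hK hx.1.continuousOn hxK hS⟩

end RSGF

theorem mainTheorem4 (d q : ℕ)
    (V₀ : EuclideanSpace ℝ (Fin d) → ℝ) (V : Fin q → EuclideanSpace ℝ (Fin d) → ℝ)
    (α : ℝ) (β : EuclideanSpace ℝ (Fin d) → ℝ)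
    (hα : 0 < α) (hβ : ∀ θ, 0 < β θ)
    (hV₀ : ContDiff ℝ 2 V₀) (hV : ∀ j, ContDiff ℝ 2 (V j)) (hβ' : ContDiff ℝ 2 β)
    (hin : RSGF.CQInside V₀ V α β) :
    (∀ x : ℝ → EuclideanSpace ℝ (Fin d),
      RSGF.IsBoundedTrajectory V₀ V α β x → x 0 ∈ RSGF.feasibleSet V →
        RSGF.ConvergesToSet x (RSGF.kktSet V₀ V) ∧
        (RSGF.AllIsolated (RSGF.kktSet V₀ V) →
          ∃ y ∈ RSGF.kktSet V₀ V, Filter.Tendsto x Filter.atTop (nhds y))) ∧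
    (RSGF.CQOutside V₀ V α β →
      ∀ x : ℝ → EuclideanSpace ℝ (Fin d),
        RSGF.IsBoundedTrajectory V₀ V α β x →
          RSGF.ConvergesToSet x (RSGF.kktSet V₀ V) ∧
          (RSGF.AllIsolated (RSGF.kktSet V₀ V) →
            ∃ y ∈ RSGF.kktSet V₀ V, Filter.Tendsto x Filter.atTop (nhds y))) := by
  have hmfcq : ∀ θ ∈ RSGF.feasibleSet V, RSGF.MFCQ V θ := fun θ hθ => (hin θ hθ).1
  have hslater : ∀ y ∈ RSGF.feasibleSet V,
      RSGF.Slater fun j => RSGF.dirConstraint V α β j y := by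
    intro y hy
    obtain ⟨z, hz⟩ := hmfcq y hy
    obtain ⟨s, hs⟩ := (RSGF.eventually_dirConstraint_smul_neg (β := β) hα hy hz).exists
    exact ⟨s • z, hs⟩
  refine ⟨fun x hx h0 => hx.convergence hα hβ hV₀ hV hβ'.continuous hmfcq fun y hy => ?_,
    fun hout x hx => hx.convergence hα hβ hV₀ hV hβ'.continuous hmfcq fun y _ => ?_⟩
  -- The orbit stays in the closed feasible set, hence so does its closure.
  · refine hslater y (closure_minimal ?_ (RSGF.isClosed_feasibleSet hV) hy)
    rintro _ ⟨t, ht, rfl⟩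
    exact hx.1.mem_feasibleSet hβ hV hβ'.continuous hslater h0 ht
  · by_cases hy : y ∈ RSGF.feasibleSet V
    · exact hslater y hy
    · exact (hout y hy).1
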